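/- Let $k$ be a field and let $A$, $B$ be unital associative $k$-algebras, with $A$ left noetherian and $B$ right noetherian. Let $R$ be a dualizing complex over $(A,B)$, that is, an object of $\mathsf{D}^{b}(\mathrm{Mod}\, A\otimes_k B^{op})$ that has finite injective dimension over $A$ and over $B^{op}$, whose cohomology modules are finitely generated over $A$ and over $B^{op}$, and for which the canonical morphisms $B\to \mathrm{RHom}_A(R,R)$ and $A\to \mathrm{RHom}_{B^{op}}(R,R)$ are isomorphisms. Suppose that for every two-sided ideal $\mathfrak{b}\subsetneq B$ (including $\mathfrak b=0$) the quotient ring $B/\mathfrak{b}$ is not right artinian. Let $S$ be a simple (left) $A$-module with injective hull $E(S)$, and let $R\to I$ be a minimal injective resolution of $R$ as a complex of $A$-modules, i.e. a quasi-isomorphism to a bounded below complex $I$ of injective $A$-modules such that $\mathrm{Ker}(I^i\to I^{i+1})$ is an essential submodule of $I^i$ for every $i$. Then for every integer $i$ the module $I^i$ is a direct sum of indecomposable submodules, and in every such decomposition the number of summands isomorphic to $E(S)$ (the multiplicity of $E(S)$ in $I^i$) is either $0$ or infinite. -/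

import Mathlib

open CategoryTheory
open scoped TensorProduct

universe w u

namespace NCDualizing

noncomputable section

/-! ### Modules: essential submodules, injective hulls, indecomposable decompositions -/

/-- `N` is an essential submodule of `M`: it meets every nonzero submodule nontrivially. -/
def IsEssential {A M : Type u} [Ring A] [AddCommGroup M] [Module A M]
    (N : Submodule A M) : Prop :=
  ∀ P : Submodule A M, N ⊓ P = ⊥ → P = ⊥

/-- `f : S → E` exhibits `E` as an injective hull of `S`: the module `E` is injective, and `f` is an
injection with essential image. -/
structure IsInjectiveHull {A S E : Type u} [Ring A] [AddCommGroup S] [Module A S]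
    [AddCommGroup E] [Module A E] (f : S →ₗ[A] E) : Prop where
  injective_module : Module.Injective A E
  injective_map : Function.Injective f
  essential : IsEssential (LinearMap.range f)

/-- A module is indecomposable if it is nonzero and is not the internal direct sum of two
nonzero submodules. -/
def IsIndecomposable (A M : Type u) [Ring A] [AddCommGroup M] [Module A M] : Prop :=
  Nontrivial M ∧ ∀ P Q : Submodule A M, IsCompl P Q → P = ⊥ ∨ Q = ⊥

/-- `M` is the internal direct sum of the submodules belonging to the set `s`, and each of them is
indecomposable. (As the summands are independent and nonzero, nothing is lost by indexing
them by themselves.) -/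
structure IsIndecomposableDecomposition {A M : Type u} [Ring A] [AddCommGroup M] [Module A M]
    (s : Set (Submodule A M)) : Prop where
  independent : sSupIndep s
  sSup_eq_top : sSup s = ⊤
  indecomposable : ∀ N ∈ s, IsIndecomposable A N

/-- The multiplicity of `E` in the decomposition `s` of `M`: the number of members of `s` that
are isomorphic to `E` (`⊤` if there are infinitely many). -/
def multiplicityIn {A M : Type u} [Ring A] [AddCommGroup M] [Module A M]
    (s : Set (Submodule A M)) (E : Type u) [AddCommGroup E] [Module A E] : ℕ∞ :=
  Set.encard {N ∈ s | Nonempty (N ≃ₗ[A] E)}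

/-! ### Complexes of modules -/

/-- A minimal injective complex: a bounded below complex of injective modules in which every module
of cocycles is essential. -/
structure IsMinimalInjectiveComplex {A : Type u} [Ring A]
    (I : CochainComplex (ModuleCat.{u} A) ℤ) : Prop where
  boundedBelow : ∃ n : ℤ, ∀ i < n, Limits.IsZero (I.X i)
  injective : ∀ i, Injective (I.X i)
  essential : ∀ i, IsEssential (LinearMap.ker (I.d i (i + 1)).hom)

/-- A minimal injective resolution of the complex `M`: a quasi-isomorphism to a minimal injective
complex. -/
structure IsMinimalInjectiveResolution {A : Type u} [Ring A]
    {M I : CochainComplex (ModuleCat.{u} A) ℤ} (φ : M ⟶ I) : Prop where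
  quasiIso : QuasiIso φ
  minimal : IsMinimalInjectiveComplex I

/-- `M` has finite injective dimension: it is quasi-isomorphic to a bounded complex of injective
modules. -/
def HasFiniteInjectiveDimension {A : Type u} [Ring A]
    (M : CochainComplex (ModuleCat.{u} A) ℤ) : Prop :=
  ∃ (J : CochainComplex (ModuleCat.{u} A) ℤ) (φ : M ⟶ J), QuasiIso φ ∧
    (∃ m n : ℤ, ∀ i, i < m ∨ n < i → Limits.IsZero (J.X i)) ∧ ∀ i, Injective (J.X i)

/-- The complex of `C`-modules underlying a complex of `T`-modules, along `f : C → T`. -/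
abbrev restrict {C T : Type u} [Ring C] [Ring T] (f : C →+* T)
    (R : CochainComplex (ModuleCat.{u} T) ℤ) : CochainComplex (ModuleCat.{u} C) ℤ :=
  ((ModuleCat.restrictScalars.{u} f).mapHomologicalComplex (ComplexShape.up ℤ)).obj R

/-- Multiplication by an element `t : T` that commutes with the image of `f : C → T`, as a
`C`-linear endomorphism of (the restriction to `C` of) a `T`-module. -/
def smulHom {C T : Type u} [Ring C] [Ring T] (f : C →+* T) (t : T)
    (h : ∀ c, Commute (f c) t) (M : ModuleCat.{u} T) :
    (ModuleCat.restrictScalars.{u} f).obj M ⟶ (ModuleCat.restrictScalars.{u} f).obj M :=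
  ModuleCat.ofHom
    (X := (ModuleCat.restrictScalars.{u} f).obj M) (Y := (ModuleCat.restrictScalars.{u} f).obj M)
    { toFun := fun x => (t • (show M from x) : M)
      map_add' := fun x y => smul_add t (show M from x) (show M from y)
      map_smul' := fun c x => by
        change t • (f c • (show M from x)) = f c • (t • (show M from x))
        rw [smul_smul, smul_smul, (h c).eq] }

/-- Multiplication by an element `t : T` that commutes with the image of `f : C → T`, as an
endomorphism of a complex of `C`-modules. -/
def smulEnd {C T : Type u} [Ring C] [Ring T] (f : C →+* T) (t : T)
    (h : ∀ c, Commute (f c) t) (R : CochainComplex (ModuleCat.{u} T) ℤ) :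
    restrict f R ⟶ restrict f R where
  f i := smulHom f t h (R.X i)
  comm' i j _ := by
    ext x
    exact (R.d i j).hom.map_smul t x

section

attribute [local instance] HasDerivedCategory.standard

/-- For commuting ring maps `f : C → T` and `g : D → T` and a complex `R` of `T`-modules: the
canonical morphism `D → RHom_C(R, R)`, given by the action of `D` on `R`, is an isomorphism.
As `Hⁿ(RHom_C(R, R)) = Hom(R, R[n])`, morphisms in the derived category of `C`-modules, this says
that `D → Hom(R, R)` is bijective and `Hom(R, R[n]) = 0` for all `n ≠ 0`. -/
def IsHomothetyIso {C D T : Type u} [Ring C] [Ring D] [Ring T] (f : C →+* T) (g : D →+* T)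
    (h : ∀ c d, Commute (f c) (g d)) (R : CochainComplex (ModuleCat.{u} T) ℤ) : Prop :=
  Function.Bijective (fun d : D =>
      (DerivedCategory.Q.map (smulEnd f (g d) (fun c => h c d) R) :
        DerivedCategory.Q.obj (restrict f R) ⟶ DerivedCategory.Q.obj (restrict f R))) ∧
    ∀ n : ℤ, n ≠ 0 →
      ∀ α : DerivedCategory.Q.obj (restrict f R) ⟶ (DerivedCategory.Q.obj (restrict f R))⟦n⟧, α = 0

end

/-! ### Dualizing complexes -/

section

variable (k : Type w) (A B : Type u) [Field k] [Ring A] [Algebra k A] [Ring B] [Algebra k B]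

/-- The ring `A ⊗ Bᵒᵖ`, whose left modules are the `A`-`B`-bimodules. -/
abbrev BimodRing : Type u := A ⊗[k] Bᵐᵒᵖ

/-- The ring map `A → A ⊗ Bᵒᵖ`. -/
abbrev inlHom : A →+* BimodRing k A B :=
  (Algebra.TensorProduct.includeLeft : A →ₐ[k] A ⊗[k] Bᵐᵒᵖ).toRingHom

/-- The ring map `Bᵒᵖ → A ⊗ Bᵒᵖ`. -/
abbrev inrHom : Bᵐᵒᵖ →+* BimodRing k A B :=
  (Algebra.TensorProduct.includeRight : Bᵐᵒᵖ →ₐ[k] A ⊗[k] Bᵐᵒᵖ).toRingHom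

theorem commute_inl_inr (a : A) (b : Bᵐᵒᵖ) : Commute (inlHom k A B a) (inrHom k A B b) := by
  simp [Commute, SemiconjBy, Algebra.TensorProduct.tmul_mul_tmul]

/-- A dualizing complex over `(A, B)`, where `A` is a left noetherian and `B` a right noetherian
`k`-algebra: an object of the bounded derived category of `A ⊗ Bᵒᵖ`-modules, represented by
a complex `R` with bounded cohomology, with the properties listed. -/
structure IsDualizingComplex (R : CochainComplex (ModuleCat.{u} (BimodRing k A B)) ℤ) : Prop where
  noetherian_left : IsNoetherianRing A
  noetherian_right : IsNoetherianRing Bᵐᵒᵖ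
  bounded : ∃ m n : ℤ, ∀ i, i < m ∨ n < i → Limits.IsZero (R.homology i)
  injDim_left : HasFiniteInjectiveDimension (restrict (inlHom k A B) R)
  injDim_right : HasFiniteInjectiveDimension (restrict (inrHom k A B) R)
  finite_left : ∀ i, Module.Finite A ((restrict (inlHom k A B) R).homology i)
  finite_right : ∀ i, Module.Finite Bᵐᵒᵖ ((restrict (inrHom k A B) R).homology i)
  homothety_right : IsHomothetyIso (inlHom k A B) (inrHom k A B) (commute_inl_inr k A B) R
  homothety_left : IsHomothetyIso (inrHom k A B) (inlHom k A B)
    (fun b a => (commute_inl_inr k A B a b).symm) R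

end

end

end NCDualizing

/-! The cocycles of I are essential, so they contain the image of every map from S. Hence Hom_A(S,
I) has zero differentials, and V = Hom_A(S, I^i) is Ext^i_A(S, R) (`homSimple`, bijective). It
carries two commuting actions: B acts on the right through R, and the division ring D = End_A(S)ᵒᵖ
acts through S.

Over Bᵒᵖ, V is noetherian: every morphism A → R[j] comes from a cocycle of R, so Hom(A, R[j]) is a
quotient of H^j(R) (`isNoetherian_homModule_free`), and dimension shifting passes from A to S
(`isNoetherian_homModule_of_finite`). Over D, the size of V is read off from the multiplicity of
E(S) in I^i: V is nonzero if the multiplicity is nonzero, and finite-dimensional if it is finite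
(`IsIndecomposableDecomposition.exists_span_hom`).

Suppose the multiplicity is finite and nonzero. Then T = End_D(V) is artinian, and noetherian as a
left Bᵒᵖ-module. Playing an ascending chain of Bᵒᵖ-submodules of T against a descending chain of
left ideals of T gives b^m ∈ Θ b^(m+1) for each b in the image Θ of Bᵒᵖ in T
(`exists_map_mul_pow_succ_eq_pow`). This produces enough idempotents to make Θ modulo its Jacobson
radical semisimple (`isSemisimpleRing_quotient_jacobson`). So B has a right artinian quotient by a
proper ideal, a contradiction.

Decompositions exist by Matlis' argument: over a noetherian ring direct sums of injectives are
injective (`injective_sSup`), so a maximal independent family of indecomposable injectives exhausts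
the module. -/

namespace NCDualizing

noncomputable section

/-! ### Left noetherian rings with many idempotents -/

section Idempotents

variable {R : Type*} [Ring R]

/-- A left noetherian ring in which every nonzero left ideal contains a nonzero idempotent is
semisimple. -/
theorem isSemisimpleRing_of_exists_idempotent [IsNoetherianRing R]
    (h : ∀ K : Ideal R, K ≠ ⊥ → ∃ e ∈ K, e ≠ 0 ∧ e * e = e) : IsSemisimpleRing R := by
  refine (isSemisimpleModule_iff R R).2 ⟨fun (K : Ideal R) => ?_⟩
  -- A maximal Rf with f an idempotent of K will turn out to be all of K, with complement R(1 - f).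
  let s : Set (Ideal R) := {L | ∃ f ∈ K, f * f = f ∧ L = Ideal.span {f}}
  obtain ⟨_, ⟨f, hfK, hf, rfl⟩, hmax⟩ :=
    set_has_maximal_iff_noetherian.2 (inferInstance : IsNoetherian R R) s
      ⟨_, 0, K.zero_mem, by simp, rfl⟩
  have hK : ∀ k ∈ K, k = k * f := by
    intro k hk
    by_contra hne
    have hx : k - k * f ≠ 0 := sub_ne_zero.2 hne
    obtain ⟨y, hy, hy0, hyy⟩ := h (Ideal.span {k - k * f}) (by simpa using hx)
    obtain ⟨r, rfl⟩ := Ideal.mem_span_singleton'.1 hy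
    have hyf : r * (k - k * f) * f = 0 := by
      rw [mul_assoc, sub_mul, mul_assoc, hf, sub_self, mul_zero]
    have hyK : r * (k - k * f) ∈ K := K.mul_mem_left _ (K.sub_mem hk (K.mul_mem_left _ hfK))
    generalize r * (k - k * f) = y at *
    have h1 : f * (f + y - f * y) = f := by
      rw [mul_sub, mul_add, ← mul_assoc, hf, add_sub_cancel_right]
    have h2 : y * (f + y - f * y) = y := by
      rw [mul_sub, mul_add, ← mul_assoc, hyf, hyy]; simp
    -- Since yf = 0, the element g = f + y - fy satisfies fg = f and yg = y. So g is idempotent and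
    -- Rg contains both Rf and y, while y ∈ Rf would give y = yf = 0.
    refine hmax (Ideal.span {f + y - f * y}) ⟨f + y - f * y,
      K.sub_mem (K.add_mem hfK hyK) (K.mul_mem_left _ hyK), ?_, rfl⟩ ?_
    · conv_lhs => rw [sub_mul, add_mul, mul_assoc, h1, h2]
    · refine lt_of_le_of_ne ?_ fun heq => hy0 ?_
      · rw [Ideal.span_singleton_le_iff_mem]
        exact Ideal.mem_span_singleton'.2 ⟨f, h1⟩
      · have : y ∈ Ideal.span {f} := heq ▸ Ideal.mem_span_singleton'.2 ⟨y, h2⟩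
        obtain ⟨t, ht⟩ := Ideal.mem_span_singleton'.1 this
        rw [← hyf, ← ht, mul_assoc, hf]
  refine ⟨Ideal.span {1 - f}, ?_, ?_⟩
  · rw [Submodule.disjoint_def]
    intro x hx hx'
    obtain ⟨t, rfl⟩ := Ideal.mem_span_singleton'.1 hx'
    rw [hK _ hx, mul_assoc, sub_mul, hf]; simp
  · rw [codisjoint_iff, Ideal.eq_top_iff_one]
    refine Submodule.mem_sup.2 ⟨f, hfK, 1 - f, Ideal.mem_span_singleton_self _, by abel⟩

/-- In a left noetherian ring, `d * a * a = a` implies `a * d * a = a`. -/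
theorem mul_mul_self_of_left_regular [IsNoetherianRing R] {a d : R} (h : d * a * a = a) :
    a * d * a = a := by
  let P : Ideal R := Ideal.span {a}
  have ha : a ∈ P := Ideal.mem_span_singleton_self a
  -- Right multiplication by a on Ra is surjective by the hypothesis, hence injective by
  -- noetherianity; it sends a d a and a to the same element.
  let f : P →ₗ[R] P :=
    { toFun := fun x => ⟨x.1 * a, P.mul_mem_left _ ha⟩
      map_add' := fun x y => Subtype.ext (add_mul _ _ _)
      map_smul' := fun r x => Subtype.ext (mul_assoc _ _ _) }
  have hf : Function.Surjective f := by
    rintro ⟨x, hx⟩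
    obtain ⟨t, rfl⟩ := Ideal.mem_span_singleton'.1 hx
    refine ⟨⟨t * (d * a), P.mul_mem_left _ (P.mul_mem_left _ ha)⟩, Subtype.ext ?_⟩
    change t * (d * a) * a = t * a
    rw [mul_assoc, h]
  have hinj := IsNoetherian.injective_of_surjective_endomorphism f hf
  have := @hinj ⟨a * d * a, P.mul_mem_left _ ha⟩ ⟨a, ha⟩ (Subtype.ext ?_)
  · exact congrArg Subtype.val this
  · change a * d * a * a = a * a
    rw [mul_assoc a d a, mul_assoc a (d * a) a, h]

/-- The element 1 - e has a left inverse and kills e. -/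
theorem eq_zero_of_mem_jacobson_of_idempotent {e : R} (he : e ∈ Ring.jacobson R)
    (hee : e * e = e) : e = 0 := by
  rw [Ring.jacobson_eq_sInf_isMaximal] at he
  have he' : e ∈ Ideal.jacobson (⊥ : Ideal R) := by
    simpa [Ideal.jacobson] using he
  obtain ⟨z, hz⟩ := Ideal.mem_jacobson_iff.1 he' (-1)
  have hz' : z - z * e = 1 := by
    have : z * -1 * e + z - 1 = 0 := hz
    rw [mul_neg, mul_one, neg_mul] at this
    rw [sub_eq_zero] at this
    rw [← this]; abel
  calc e = (z - z * e) * e := by rw [hz', one_mul]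
    _ = 0 := by rw [sub_mul, mul_assoc, hee, sub_self]

/-- Nil left ideals are quasi-regular: 1 + rb is a unit whenever rb is nilpotent. -/
theorem mem_jacobson_of_forall_isNilpotent {b : R} (h : ∀ r, IsNilpotent (r * b)) :
    b ∈ Ring.jacobson R := by
  have : b ∈ Ideal.jacobson (⊥ : Ideal R) := by
    refine Ideal.mem_jacobson_iff.2 fun y => ?_
    obtain ⟨v, hv⟩ := (h y).isUnit_add_one
    refine ⟨↑v⁻¹, ?_⟩
    have : (↑v⁻¹ : R) * (y * b + 1) = 1 := by rw [← hv]; simp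
    rw [mul_add, mul_one, ← mul_assoc] at this
    simp [this]
  rw [Ring.jacobson_eq_sInf_isMaximal]
  simpa [Ideal.jacobson] using this

/-- A left noetherian ring in which each element `b` satisfies `b ^ m ∈ R * b ^ (m + 1)` for
some `m` is semisimple modulo its Jacobson radical. -/
theorem isSemisimpleRing_quotient_jacobson [IsNoetherianRing R]
    (h : ∀ b : R, ∃ (c : R) (m : ℕ), c * b ^ (m + 1) = b ^ m) :
    IsSemisimpleRing (R ⧸ Ring.jacobson R) := by
  -- With a = b^(m+1), iterating the hypothesis gives c^(m+1) a a = a, hence a c^(m+1) a = a. So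
  -- c^(m+1) a is an idempotent in Rb, and d = c^(m+1) b^m.
  have hidem : ∀ b : R, ¬ IsNilpotent b → ∃ d : R, d * b ≠ 0 ∧ d * b * (d * b) = d * b := by
    intro b hb
    obtain ⟨c, m, hc⟩ := h b
    have hpow : ∀ j, c ^ j * b ^ (m + j) = b ^ m := by
      intro j
      induction j with
      | zero => simp
      | succ j ih =>
        rw [pow_succ, mul_assoc, show m + (j + 1) = m + 1 + j by omega, pow_add b (m + 1),
          ← mul_assoc c, hc, ← pow_add, ih]
    have hd : c ^ (m + 1) * b ^ (m + 1) * b ^ (m + 1) = b ^ (m + 1) := by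
      rw [mul_assoc, ← pow_add, show m + 1 + (m + 1) = m + (m + 1) + 1 by omega, pow_succ b,
        ← mul_assoc, hpow, ← pow_succ]
    have hreg := mul_mul_self_of_left_regular hd
    have hE : c ^ (m + 1) * b ^ m * b = c ^ (m + 1) * b ^ (m + 1) := by
      rw [mul_assoc, ← pow_succ]
    refine ⟨c ^ (m + 1) * b ^ m, fun h0 => hb ⟨m + 1, ?_⟩, ?_⟩
    · rw [← hd, ← hE, h0, zero_mul]
    · rw [hE, mul_assoc, ← mul_assoc (b ^ (m + 1)), hreg]
  have : IsNoetherianRing (R ⧸ Ring.jacobson R) :=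
    isNoetherianRing_of_surjective _ _ _ (Ideal.Quotient.mk_surjective (I := Ring.jacobson R))
  refine isSemisimpleRing_of_exists_idempotent fun K hK => ?_
  obtain ⟨x, hx, hx0⟩ := Submodule.exists_mem_ne_zero_of_ne_bot hK
  obtain ⟨b, rfl⟩ := Ideal.Quotient.mk_surjective x
  have hb : b ∉ Ring.jacobson R := fun hb => hx0 (Ideal.Quotient.eq_zero_iff_mem.2 hb)
  -- Outside the radical some multiple of b is not nilpotent; the idempotent it yields survives in
  -- the quotient because the radical has no nonzero idempotents.
  obtain ⟨r, hr⟩ : ∃ r, ¬ IsNilpotent (r * b) := by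
    by_contra! hcon
    exact hb (mem_jacobson_of_forall_isNilpotent hcon)
  obtain ⟨d, hd0, hd⟩ := hidem _ hr
  refine ⟨Ideal.Quotient.mk _ (d * (r * b)), ?_, fun h0 => hd0 ?_, by rw [← map_mul, hd]⟩
  · rw [map_mul, map_mul]
    exact K.mul_mem_left _ (K.mul_mem_left _ hx)
  · exact eq_zero_of_mem_jacobson_of_idempotent (Ideal.Quotient.eq_zero_iff_mem.1 h0) hd

end Idempotents

/-! ### Bimodules that are noetherian on one side and finite-dimensional on the other -/

section Lenagan

variable {R T : Type*} [Ring R] [Ring T]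

/-- Let `θ : R → T` be a ring map that makes `T` a noetherian left `R`-module, where `T` is left
artinian. Then `θ b ^ m ∈ θ R * θ b ^ (m + 1)` for some `m`. -/
theorem exists_map_mul_pow_succ_eq_pow [Module R T] [IsNoetherian R T] [IsArtinianRing T]
    (θ : R →+* T) (hθ : ∀ (r : R) (t : T), r • t = θ r * t) (b : R) :
    ∃ (c : R) (m : ℕ), θ c * θ b ^ (m + 1) = θ b ^ m := by
  -- The submodules {f ∈ T | f θ(b)^k ∈ θ(R)} increase with k; the left ideals T θ(b)^k below
  -- decrease.
  let N : ℕ →o Submodule R T :=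
    { toFun := fun k =>
        { carrier := {f | ∃ r, f * θ b ^ k = θ r}
          add_mem' := by
            rintro f g ⟨r, hr⟩ ⟨s, hs⟩
            exact ⟨r + s, by rw [add_mul, hr, hs, map_add]⟩
          zero_mem' := ⟨0, by simp⟩
          smul_mem' := by
            rintro t f ⟨r, hr⟩
            exact ⟨t * r, by rw [hθ, mul_assoc, hr, map_mul]⟩ }
      monotone' := monotone_nat_of_le_succ fun k f ⟨r, hr⟩ =>
        ⟨r * b, by rw [pow_succ, ← mul_assoc, hr, map_mul]⟩ }
  obtain ⟨k, hk⟩ := monotone_stabilizes_iff_noetherian.2 (inferInstance : IsNoetherian R T) N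
  let P : ℕ →o (Ideal T)ᵒᵈ :=
    { toFun := fun k => OrderDual.toDual (Ideal.span {θ b ^ k})
      monotone' := monotone_nat_of_le_succ fun k => by
        change Ideal.span {θ b ^ (k + 1)} ≤ Ideal.span {θ b ^ k}
        rw [Ideal.span_singleton_le_iff_mem, pow_succ']
        exact Ideal.mul_mem_left _ _ (Ideal.mem_span_singleton_self _) }
  obtain ⟨l, hl⟩ := IsArtinian.monotone_stabilizes (R := T) (M := T) P
  set m := max k l
  have hf : ∀ j, ∃ f : T, f * θ b ^ (m + j) = θ b ^ m := by
    intro j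
    have h1 : P m = P (m + j) := by
      rw [← hl m (le_max_right _ _), ← hl (m + j) (by omega)]
    have : θ b ^ m ∈ Ideal.span {θ b ^ (m + j)} := by
      have h2 : Ideal.span {θ b ^ m} = Ideal.span {θ b ^ (m + j)} := h1
      rw [← h2]
      exact Ideal.mem_span_singleton_self _
    exact Ideal.mem_span_singleton'.1 this
  -- Now f θ(b)^(2m+1) = θ(b)^m lies in θ(R). Stability of `N` from m on already puts f θ(b)^m in
  -- θ(R), and this element is θ(c).
  obtain ⟨f, hf⟩ := hf (m + 1)
  have h1 : f ∈ N (m + (m + 1)) := ⟨b ^ m, by rw [hf, map_pow]⟩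
  rw [← hk _ (by omega), hk m (le_max_left _ _)] at h1
  obtain ⟨c, hc⟩ := h1
  exact ⟨c, m, by rw [← hc, mul_assoc, ← pow_add, hf]⟩

/-- A nonzero module `V` over a left noetherian ring `R` that is finitely generated and has finite
dimension over a division ring `D` whose action commutes with that of `R`: then `R` has a nonzero
semisimple quotient ring. -/
theorem exists_surjective_isSemisimpleRing (D : Type*) (V : Type w) [DivisionRing D]
    [AddCommGroup V]
    [Module R V] [Module D V] [SMulCommClass R D V] [IsNoetherianRing R] [IsNoetherian R V]
    [Module.Finite D V] [Nontrivial V] :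
    ∃ (S : Type w) (_ : Ring S) (f : R →+* S), Function.Surjective f ∧ Nontrivial S ∧
      IsSemisimpleRing S := by
  have := SMulCommClass.symm R D V
  let θ := Module.toModuleEnd D (S := R) V
  have hT : IsNoetherian R (Module.End D V) := by
    obtain ⟨n, v, hv⟩ := Module.Finite.exists_fin (R := D) (M := V)
    -- Evaluation on a finite D-spanning family embeds End_D(V) into V^n over R, so it inherits
    -- noetherianity.
    let ev : Module.End D V →ₗ[R] (Fin n → V) :=
      { toFun := fun f i => f (v i)
        map_add' := fun f g => rfl
        map_smul' := fun r f => rfl }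
    refine isNoetherian_of_injective ev fun f g hfg => ?_
    exact LinearMap.ext_on_range hv fun i => congrFun hfg i
  have : IsArtinianRing (Module.End D V) :=
    have := IsSemisimpleRing.moduleEnd D V
    inferInstance
  have hR : IsNoetherianRing θ.range := isNoetherianRing_range θ
  have := isSemisimpleRing_quotient_jacobson (R := θ.range) (by
    rintro ⟨_, b, rfl⟩
    obtain ⟨c, m, hc⟩ := exists_map_mul_pow_succ_eq_pow θ (fun r t => rfl) b
    exact ⟨⟨θ c, c, rfl⟩, m, Subtype.ext (by simpa using hc)⟩)
  have hnt : Nontrivial θ.range := inferInstance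
  exact ⟨θ.range ⧸ Ring.jacobson θ.range, inferInstance,
    (Ideal.Quotient.mk (Ring.jacobson θ.range)).comp θ.rangeRestrict,
    Ideal.Quotient.mk_surjective.comp θ.rangeRestrict_surjective,
    Ideal.Quotient.nontrivial_iff.2 (Ring.jacobson_lt_top θ.range).ne, this⟩

/-- Passing to opposite rings turns a left artinian quotient of Bᵒᵖ into a right artinian quotient
of B. -/
theorem exists_twoSidedIdeal_of_surjective {B S : Type*} [Ring B] [Ring S] [Nontrivial S]
    [IsArtinianRing S] (f : Bᵐᵒᵖ →+* S) (hf : Function.Surjective f) :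
    ∃ b : TwoSidedIdeal B, b ≠ ⊤ ∧ IsArtinianRing (b.ringCon.Quotient)ᵐᵒᵖ := by
  let g : B →+* Sᵐᵒᵖ := (RingHom.op f).comp (RingEquiv.opOp B).toRingHom
  have hg : Function.Surjective g := fun x => by
    obtain ⟨y, hy⟩ := hf x.unop
    exact ⟨y.unop, congrArg MulOpposite.op hy⟩
  let e : (TwoSidedIdeal.ker g).ringCon.Quotient ≃+* Sᵐᵒᵖ :=
    RingCon.quotientKerEquivOfSurjective g hg
  refine ⟨TwoSidedIdeal.ker g, fun h => ?_, ?_⟩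
  · have : (1 : B) ∈ TwoSidedIdeal.ker g := h ▸ trivial
    rw [TwoSidedIdeal.mem_ker, map_one] at this
    exact one_ne_zero this
  · exact ((RingEquiv.opOp S).trans (RingEquiv.op e.symm)).isArtinianRing

/-- A right noetherian ring `B` has a proper two-sided ideal with right artinian quotient as soon
as it has a nonzero noetherian right module of finite dimension over a division ring whose action
commutes with that of `B`. -/
theorem exists_twoSidedIdeal_isArtinianRing (B D V : Type*) [Ring B] [DivisionRing D]
    [AddCommGroup V] [Module Bᵐᵒᵖ V] [Module D V] [SMulCommClass Bᵐᵒᵖ D V] [IsNoetherianRing Bᵐᵒᵖ]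
    [IsNoetherian Bᵐᵒᵖ V] [Module.Finite D V] [Nontrivial V] :
    ∃ b : TwoSidedIdeal B, b ≠ ⊤ ∧ IsArtinianRing (b.ringCon.Quotient)ᵐᵒᵖ := by
  obtain ⟨S, _, f, hf, _, _⟩ := exists_surjective_isSemisimpleRing (R := Bᵐᵒᵖ) D V
  exact exists_twoSidedIdeal_of_surjective f hf

end Lenagan

/-! ### Injective modules over noetherian rings -/

section Injective

variable {A M : Type u} [Ring A] [AddCommGroup M] [Module A M]

theorem injective_of_isCompl [Module.Injective A M] {N C : Submodule A M} (h : IsCompl N C) :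
    Module.Injective A N where
  out X Y _ _ _ _ f hf g := by
    obtain ⟨l, hl⟩ := Module.Injective.out f hf (N.subtype ∘ₗ g)
    refine ⟨N.projectionOnto C h ∘ₗ l, fun x => ?_⟩
    rw [LinearMap.comp_apply, hl]
    exact Submodule.projectionOnto_apply_left h (g x)

theorem exists_isCompl_of_injective (N : Submodule A M) [Module.Injective A N] :
    ∃ C, IsCompl N C := by
  obtain ⟨p, hp⟩ := Module.Injective.out (R := A) N.subtype N.injective_subtype LinearMap.id
  exact ⟨_, LinearMap.isCompl_of_proj (f := p) hp⟩

theorem injective_of_linearEquiv {N : Type u} [AddCommGroup N] [Module A N]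
    [Module.Injective A M] (e : M ≃ₗ[A] N) : Module.Injective A N where
  out X Y _ _ _ _ f hf g := by
    obtain ⟨l, hl⟩ := Module.Injective.out f hf (e.symm.toLinearMap ∘ₗ g)
    exact ⟨e.toLinearMap ∘ₗ l, fun x => by simp [hl]⟩

theorem injective_prod (N P : Type u) [AddCommGroup N] [Module A N] [AddCommGroup P] [Module A P]
    [Module.Injective A N] [Module.Injective A P] : Module.Injective A (N × P) where
  out X Y _ _ _ _ f hf g := by
    obtain ⟨l, hl⟩ := Module.Injective.out f hf (LinearMap.fst A N P ∘ₗ g)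
    obtain ⟨l', hl'⟩ := Module.Injective.out f hf (LinearMap.snd A N P ∘ₗ g)
    exact ⟨l.prod l', fun x => Prod.ext (hl x) (hl' x)⟩

theorem coprod_subtype_injective {N P : Submodule A M} (h : Disjoint N P) :
    Function.Injective (N.subtype.coprod P.subtype) := by
  rw [← LinearMap.ker_eq_bot, LinearMap.ker_coprod_of_disjoint_range]
  · simp
  · simpa using h

theorem injective_sup {N P : Submodule A M} [Module.Injective A N] [Module.Injective A P]
    (h : Disjoint N P) : Module.Injective A ↥(N ⊔ P) := by
  have := injective_prod (A := A) N P
  have e := LinearEquiv.ofInjective _ (coprod_subtype_injective h)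
  rw [LinearMap.range_coprod, Submodule.range_subtype, Submodule.range_subtype] at e
  exact injective_of_linearEquiv e

theorem injective_sSup_of_finite {s : Set (Submodule A M)} (hs : s.Finite) (hind : sSupIndep s)
    (hinj : ∀ N ∈ s, Module.Injective A N) : Module.Injective A ↥(sSup s) := by
  induction s, hs using Set.Finite.induction_on with
  | empty =>
    rw [sSup_empty]
    exact ⟨fun X Y _ _ _ _ f hf g => ⟨0, fun x => Subsingleton.elim _ _⟩⟩
  | @insert N s hN hs ih =>
    have := ih (hind.mono (Set.subset_insert _ _)) fun P hP => hinj P (Set.mem_insert_of_mem _ hP)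
    have := hinj N (Set.mem_insert _ _)
    rw [sSup_insert]
    refine injective_sup ?_
    have h1 := hind (Set.mem_insert N s)
    rwa [Set.insert_sdiff_self_of_notMem hN] at h1

/-- Over a left noetherian ring, an internal direct sum of injective modules is injective. -/
theorem injective_sSup [IsNoetherianRing A] {s : Set (Submodule A M)} (hind : sSupIndep s)
    (hinj : ∀ N ∈ s, Module.Injective A N) : Module.Injective A ↥(sSup s) := by
  refine Module.Baer.injective fun J g => ?_
  let P : Submodule A M := LinearMap.range ((sSup s).subtype ∘ₗ g)
  have hP : P.FG := by
    have := IsNoetherian.noetherian (R := A) (M := A) J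
    have : Module.Finite A J := Module.Finite.iff_fg.2 this
    exact Module.Finite.iff_fg.1 (Module.Finite.range _)
  have hPs : P ≤ sSup s := by
    rintro _ ⟨x, rfl⟩
    exact (g x).2
  -- In Baer's criterion the image of a left ideal is finitely generated, so it lies in a finite
  -- subsum, which is injective.
  obtain ⟨t, hts, hPt⟩ :=
    (CompleteLattice.isCompactElement_iff_exists_le_sSup_of_le_sSup _ _).1
      ((Submodule.fg_iff_compact P).1 hP) s hPs
  rw [Finset.sup_id_eq_sSup] at hPt
  have := injective_sSup_of_finite t.finite_toSet (hind.mono hts) fun N hN => hinj N (hts hN)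
  obtain ⟨l, hl⟩ := Module.Injective.out (R := A) J.subtype J.injective_subtype
    (((sSup s).subtype ∘ₗ g).codRestrict (sSup t) fun x => hPt ⟨x, rfl⟩)
  refine ⟨Submodule.inclusion (sSup_le_sSup hts) ∘ₗ l, fun x hx => Subtype.ext ?_⟩
  exact congrArg (fun y : ↥(sSup (t : Set (Submodule A M))) => (y : M)) (hl ⟨x, hx⟩)

theorem exists_maximal_disjoint {U X : Submodule A M} (h : Disjoint X U) :
    ∃ W, X ≤ W ∧ Maximal (fun Y => Disjoint Y U) W := by
  refine zorn_le_nonempty₀ {Y | Disjoint Y U} (fun c hc hchain Y hY => ?_) X h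
  refine ⟨sSup c, ?_, fun Z hZ => le_sSup hZ⟩
  exact (DirectedOn.disjoint_sSup_left hchain.directedOn).2 fun Z hZ => hc hZ

/-- A submodule is uniform if any two of its nonzero submodules meet nontrivially. -/
def IsUniform (U : Submodule A M) : Prop :=
  U ≠ ⊥ ∧ ∀ P ≤ U, ∀ Q ≤ U, Disjoint P Q → P = ⊥ ∨ Q = ⊥

/-- Take P maximal among submodules that are disjoint from some nonzero U. If U contained disjoint
nonzero X and Y, then P ⊔ X would be larger and still disjoint from Y. -/
theorem exists_isUniform_of_isNoetherian [IsNoetherian A M] [Nontrivial M] :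
    ∃ U : Submodule A M, IsUniform U := by
  obtain ⟨P, ⟨U, hU, hPU⟩, hmax⟩ := set_has_maximal_iff_noetherian.2 (inferInstance)
    {P : Submodule A M | ∃ Q, Q ≠ ⊥ ∧ Disjoint P Q} ⟨⊥, ⊤, top_ne_bot, disjoint_bot_left⟩
  refine ⟨U, hU, fun X hX Y hY hXY => ?_⟩
  by_contra! hne
  refine hmax (P ⊔ X) ⟨Y, hne.2, ?_⟩ (lt_of_le_of_ne le_sup_left fun heq => hne.1 ?_)
  · exact hXY.disjoint_sup_left_of_disjoint_sup_right (hPU.mono_right (sup_le hX hY))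
  · exact disjoint_self.1 (hPU.mono (heq ▸ le_sup_right) hX)

theorem exists_isUniform_le [IsNoetherianRing A] {C : Submodule A M} (hC : C ≠ ⊥) :
    ∃ U ≤ C, IsUniform U := by
  obtain ⟨x, hx, hx0⟩ := Submodule.exists_mem_ne_zero_of_ne_bot hC
  let N : Submodule A M := Submodule.span A {x}
  have : Nontrivial N :=
    ⟨⟨x, Submodule.mem_span_singleton_self x⟩, 0, fun h => hx0 (congrArg Subtype.val h)⟩
  obtain ⟨U, hU, hU'⟩ := exists_isUniform_of_isNoetherian (A := A) (M := N)
  have key : ∀ P ≤ U.map N.subtype,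
      P = (P.comap N.subtype).map N.subtype ∧ P.comap N.subtype ≤ U := by
    intro P hP
    refine ⟨?_, ?_⟩
    · rw [Submodule.map_comap_eq, inf_eq_right.2 (hP.trans (LinearMap.map_le_range))]
    · rw [← Submodule.comap_map_eq_of_injective N.injective_subtype U]
      exact Submodule.comap_mono hP
  refine ⟨U.map N.subtype, ?_, ?_, fun P hP Q hQ hPQ => ?_⟩
  · exact (Submodule.map_subtype_le _ _).trans ((Submodule.span_singleton_le_iff_mem _ _).2 hx)
  · exact fun h => hU (Submodule.map_injective_of_injective N.injective_subtype
      (h.trans (Submodule.map_bot _).symm))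
  · have hd : Disjoint (P.comap N.subtype) (Q.comap N.subtype) := by
      rw [disjoint_iff, ← Submodule.comap_inf, disjoint_iff.1 hPQ]
      simp
    refine (hU' _ (key P hP).2 _ (key Q hQ).2 hd).imp (fun h => ?_) fun h => ?_
    · rw [(key P hP).1, h, Submodule.map_bot]
    · rw [(key Q hQ).1, h, Submodule.map_bot]

/-- A uniform submodule of an injective module has an injective hull inside it, which is
indecomposable. -/
theorem IsUniform.exists_hull [Module.Injective A M] {U : Submodule A M} (hU : IsUniform U) :
    ∃ V, U ≤ V ∧ (∀ P ≤ V, Disjoint P U → P = ⊥) ∧ Module.Injective A V ∧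
      IsIndecomposable A V := by
  obtain ⟨W, -, hW⟩ := exists_maximal_disjoint (disjoint_bot_left (a := U))
  obtain ⟨V, hUV, hV⟩ := exists_maximal_disjoint hW.prop.symm
  -- W is a maximal submodule disjoint from U, and V ⊇ U one disjoint from W. The projection W ⊕ V →
  -- V extends to q on M; the two maximality properties force ker q ≤ W and range q ≤ V, so V is a
  -- direct summand.
  obtain ⟨q, hq⟩ := Module.Injective.out (R := A) (W.subtype.coprod V.subtype)
    (coprod_subtype_injective hV.prop.symm) (V.subtype ∘ₗ LinearMap.snd A W V)
  have hqW : ∀ x ∈ W, q x = 0 := fun x hx => by simpa using hq (⟨x, hx⟩, 0)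
  have hqV : ∀ x ∈ V, q x = x := fun x hx => by simpa using hq (0, ⟨x, hx⟩)
  have hmaxW : ∀ Y, W ≤ Y → Disjoint Y U → Y ≤ W := fun Y hWY hY => hW.le_of_ge hY hWY
  have hker : LinearMap.ker q ≤ W := by
    refine hmaxW _ (fun x hx => hqW x hx) ?_
    rw [Submodule.disjoint_def]
    intro x hx hxU
    rw [← hqV x (hUV hxU)]
    exact hx
  have hrange : LinearMap.range q ≤ V := by
    refine hV.le_of_ge ?_ fun x hx => ⟨x, hqV x hx⟩
    rw [Submodule.disjoint_def]
    rintro _ ⟨y, rfl⟩ hy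
    have hle : Submodule.comap q W ≤ W := by
      refine hmaxW _ (fun x hx => by simp [hqW x hx]) ?_
      rw [Submodule.disjoint_def]
      intro x hx hxU
      rw [Submodule.mem_comap, hqV x (hUV hxU)] at hx
      exact (Submodule.disjoint_def.1 hW.prop) x hx hxU
    exact hqW y (hle hy)
  have hcompl := LinearMap.isCompl_of_proj (p := V)
    (f := q.codRestrict V fun x => hrange ⟨x, rfl⟩) fun x => Subtype.ext (hqV x x.2)
  have hess : ∀ P ≤ V, Disjoint P U → P = ⊥ := by
    intro P hPV hPU
    -- If w + p ∈ U, applying q gives p = w + p. So W ⊔ P is still disjoint from U, and maximality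
    -- of W absorbs P.
    have hPW : P ≤ W := by
      refine le_sup_right.trans (hmaxW (W ⊔ P) le_sup_left ?_)
      rw [Submodule.disjoint_def]
      intro x hx hxU
      obtain ⟨w, hw, p, hp, rfl⟩ := Submodule.mem_sup.1 hx
      have hw0 : w = 0 := by
        have h1 := hqV _ (hUV hxU)
        rw [map_add, hqW w hw, hqV p (hPV hp), zero_add] at h1
        exact left_eq_add.1 (by rw [add_comm]; exact h1)
      subst hw0
      rw [zero_add] at hxU ⊢
      exact (Submodule.disjoint_def.1 hPU) p hp hxU
    exact disjoint_self.1 (hV.prop.mono hPV hPW)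
  refine ⟨V, hUV, hess, injective_of_isCompl hcompl, ?_, fun P Q hPQ => ?_⟩
  · exact Submodule.nontrivial_iff_ne_bot.2 fun h => hU.1 (le_bot_iff.1 (h ▸ hUV))
  · have hd : Disjoint (P.map V.subtype) (Q.map V.subtype) :=
      (Submodule.disjoint_map V.injective_subtype hPQ.disjoint)
    have key : ∀ P : Submodule A V, P.map V.subtype ⊓ U = ⊥ → P = ⊥ := by
      intro P hP
      have := hess _ (Submodule.map_subtype_le V P) (disjoint_iff.2 hP)
      exact Submodule.map_injective_of_injective V.injective_subtype
        (this.trans (Submodule.map_bot _).symm)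
    exact (hU.2 _ inf_le_right _ inf_le_right (hd.mono inf_le_left inf_le_left)).imp
      (key P) (key Q)

/-- Over a left noetherian ring, every injective module is a direct sum of indecomposable
submodules. -/
theorem exists_isIndecomposableDecomposition [IsNoetherianRing A] [Module.Injective A M] :
    ∃ s : Set (Submodule A M), IsIndecomposableDecomposition s := by
  obtain ⟨s, hs⟩ := zorn_subset
    {s : Set (Submodule A M) | sSupIndep s ∧ ∀ N ∈ s, Module.Injective A N ∧ IsIndecomposable A N}
    fun c hc hchain => ⟨⋃₀ c,
      ⟨iSupIndep_sUnion_of_directed hchain.directedOn fun a ha => (hc ha).1,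
        fun N ⟨a, ha, hN⟩ => (hc ha).2 N hN⟩, fun a ha => Set.subset_sUnion_of_mem ha⟩
  have := injective_sSup hs.prop.1 fun N hN => (hs.prop.2 N hN).1
  refine ⟨s, hs.prop.1, ?_, fun N hN => (hs.prop.2 N hN).2⟩
  obtain ⟨C, hC⟩ := exists_isCompl_of_injective (sSup s)
  by_contra hne
  have hC0 : C ≠ ⊥ := fun h => hne (by simpa [h] using hC.sup_eq_top)
  obtain ⟨U, hUC, hU⟩ := exists_isUniform_le hC0
  obtain ⟨V, hUV, hess, hVinj, hVind⟩ := hU.exists_hull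
  -- The intersection is disjoint from U because U lies in the complement C; essentiality of U in V
  -- then kills it.
  have hVs : Disjoint V (sSup s) := by
    rw [disjoint_iff]
    exact hess _ inf_le_left (hC.disjoint.mono inf_le_right hUC)
  have hV0 : V ≠ ⊥ := fun h => hU.1 (le_bot_iff.1 (h ▸ hUV))
  have hVmem : V ∉ s := fun h => hV0 (disjoint_self.1 (hVs.mono_right (le_sSup h)))
  refine hVmem (hs.le_of_ge ⟨?_, ?_⟩ (Set.subset_insert V s) (Set.mem_insert V s))
  · rintro N (rfl | hN)
    · rwa [Set.insert_sdiff_self_of_notMem hVmem]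
    · have hNV : V ≠ N := fun h => hVmem (h ▸ hN)
      rw [← Set.singleton_union, Set.union_sdiff_distrib,
        Set.sdiff_singleton_eq_self (by simpa using hNV.symm), sSup_union, sSup_singleton, sup_comm]
      refine (hs.prop.1 hN).disjoint_sup_right_of_disjoint_sup_left ?_
      refine hVs.symm.mono_left (sup_le (le_sSup hN) (sSup_le_sSup Set.sdiff_subset))
  · rintro N (rfl | hN)
    · exact ⟨hVinj, hVind⟩
    · exact hs.prop.2 N hN

end Injective

/-! ### Maps from a simple module into a direct sum of indecomposable injectives -/

section Simple

variable {A S E M : Type u} [Ring A] [AddCommGroup S] [Module A S] [AddCommGroup E] [Module A E]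
  [AddCommGroup M] [Module A M]

/-- An indecomposable injective module that receives a nonzero map from a simple module is
isomorphic to the injective hull of that simple module. -/
theorem IsInjectiveHull.nonempty_equiv [IsSimpleModule A S] [Module.Injective A M]
    {ε : S →ₗ[A] E} (hε : IsInjectiveHull ε) (hM : IsIndecomposable A M) {h : S →ₗ[A] M}
    (h0 : h ≠ 0) : Nonempty (M ≃ₗ[A] E) := by
  have hinj : Function.Injective h := (LinearMap.injective_or_eq_zero h).resolve_right h0
  have := hε.injective_module
  obtain ⟨l, hl⟩ := Module.Injective.out ε hε.injective_map h
  -- The kernel of l meets the essential submodule ε(S) trivially, because l extends the injective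
  -- map h.
  have hlinj : Function.Injective l := by
    rw [← LinearMap.ker_eq_bot]
    refine hε.essential _ (eq_bot_iff.2 ?_)
    rintro _ ⟨⟨x, rfl⟩, hx⟩
    have : h x = 0 := by rw [← hl]; exact hx
    rw [(map_eq_zero_iff h hinj).1 this, map_zero]
    exact Submodule.zero_mem _
  have := injective_of_linearEquiv (LinearEquiv.ofInjective l hlinj)
  obtain ⟨C, hC⟩ := exists_isCompl_of_injective (LinearMap.range l)
  have hlsurj : Function.Surjective l := by
    rw [← LinearMap.range_eq_top]
    rcases hM.2 _ _ hC with h1 | h1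
    · refine absurd (LinearMap.ext fun x => ?_) h0
      rw [← hl, LinearMap.range_eq_bot.1 h1]; rfl
    · simpa [h1] using hC.sup_eq_top
  exact ⟨(LinearEquiv.ofBijective l ⟨hlinj, hlsurj⟩).symm⟩

/-- The image of a simple module is contained in every essential submodule. -/
theorem IsEssential.apply_mem [IsSimpleModule A S] {N : Submodule A M} (hN : IsEssential N)
    (h : S →ₗ[A] M) (x : S) : h x ∈ N := by
  rcases eq_bot_or_eq_top (N.comap h) with hb | ht
  · have h0 : LinearMap.range h = ⊥ := by
      refine hN _ (eq_bot_iff.2 ?_)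
      rintro _ ⟨hy, ⟨y, rfl⟩⟩
      have : y ∈ N.comap h := hy
      rw [hb, Submodule.mem_bot] at this
      simp [this]
    rw [LinearMap.range_eq_bot.1 h0]
    exact N.zero_mem
  · exact (ht ▸ trivial : x ∈ N.comap h)

/-- Every map from a simple module to its injective hull factors through the given inclusion. -/
theorem IsInjectiveHull.exists_comp_eq [IsSimpleModule A S] {ε : S →ₗ[A] E}
    (hε : IsInjectiveHull ε) (h : S →ₗ[A] E) : ∃ d : Module.End A S, ε ∘ₗ d = h := by
  have hmem := hε.essential.apply_mem h
  refine ⟨(LinearEquiv.ofInjective ε hε.injective_map).symm.toLinearMap ∘ₗ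
    h.codRestrict _ hmem, LinearMap.ext fun x => ?_⟩
  exact congrArg Subtype.val
    ((LinearEquiv.ofInjective ε hε.injective_map).apply_symm_apply (h.codRestrict _ hmem x))

variable {s : Set (Submodule A M)}

theorem IsIndecomposableDecomposition.isCompl (hs : IsIndecomposableDecomposition s)
    {N : Submodule A M} (hN : N ∈ s) : IsCompl N (sSup (s \ {N})) := by
  refine ⟨hs.independent hN, codisjoint_iff.2 ?_⟩
  rw [← sSup_insert, Set.insert_sdiff_singleton, Set.insert_eq_of_mem hN, hs.sSup_eq_top]

theorem IsIndecomposableDecomposition.eq_zero_of_projectionOnto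
    (hs : IsIndecomposableDecomposition s) {x : M}
    (hx : ∀ N (hN : N ∈ s), Submodule.projectionOnto N _ (hs.isCompl hN) x = 0) : x = 0 := by
  classical
  have hmem : x ∈ ⨆ N : s, (N : Submodule A M) := by
    rw [← sSup_eq_iSup', hs.sSup_eq_top]; trivial
  obtain ⟨f, hf, rfl⟩ := (Submodule.mem_iSup_iff_exists_finsupp _ _).1 hmem
  refine Finset.sum_eq_zero fun N hN => ?_
  have h1 := hx N N.2
  rw [Finsupp.sum, map_sum, Finset.sum_eq_single N] at h1
  · rw [Submodule.projectionOnto_apply_eq_zero_iff] at h1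
    exact (Submodule.disjoint_def.1 (hs.isCompl N.2).disjoint) _ (hf N) h1
  · intro P _ hPN
    rw [Submodule.projectionOnto_apply_eq_zero_iff]
    have hle : (P : Submodule A M) ≤ sSup (s \ {(N : Submodule A M)}) :=
      le_sSup ⟨P.2, fun h => hPN (Subtype.ext h)⟩
    exact hle (hf P)
  · exact fun h => absurd hN h

/-- If the injective hull of the simple module `S` has finite multiplicity in a decomposition of
the injective module `M`, then `Hom(S, M)` is finite-dimensional over the division ring
`End(S)ᵒᵖ`. -/
theorem IsIndecomposableDecomposition.exists_span_hom [IsSimpleModule A S] [Module.Injective A M]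
    (hs : IsIndecomposableDecomposition s) {ε : S →ₗ[A] E} (hε : IsInjectiveHull ε)
    (hfin : multiplicityIn s E ≠ ⊤) :
    ∃ (ι : Type u) (_ : Fintype ι) (f : ι → S →ₗ[A] M), ∀ g : S →ₗ[A] M,
      ∃ d : ι → Module.End A S, g = ∑ i, f i ∘ₗ d i := by
  classical
  let F : Set (Submodule A M) := {N ∈ s | Nonempty (N ≃ₗ[A] E)}
  have hF : F.Finite := Set.encard_ne_top_iff.1 hfin
  have e : ∀ N : F, N.1 ≃ₗ[A] E := fun N => N.2.2.some
  refine ⟨F, hF.fintype, fun N => N.1.subtype ∘ₗ (e N).symm.toLinearMap ∘ₗ ε, fun g => ?_⟩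
  let := hF.fintype
  -- Each component of g in a copy of E factors through ε; the resulting endomorphisms of S are the
  -- coordinates of g.
  have hd : ∀ N : F, ∃ d : Module.End A S, ε ∘ₗ d =
      (e N).toLinearMap ∘ₗ Submodule.projectionOnto N.1 _ (hs.isCompl N.2.1) ∘ₗ g :=
    fun N => hε.exists_comp_eq _
  choose d hd using hd
  have hd' : ∀ (N : F) (x : S), (((e N).symm (ε (d N x)) : N.1) : M) =
      Submodule.projectionOnto N.1 _ (hs.isCompl N.2.1) (g x) := by
    intro N x
    have := LinearMap.congr_fun (hd N) x
    simp only [LinearMap.comp_apply, LinearEquiv.coe_coe] at this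
    rw [this, LinearEquiv.symm_apply_apply]
  refine ⟨d, LinearMap.ext fun x => sub_eq_zero.1 (hs.eq_zero_of_projectionOnto fun N hN => ?_)⟩
  have hproj : ∀ P : F, P.1 ≠ N → Submodule.projectionOnto N _ (hs.isCompl hN)
      ((e P).symm (ε (d P x)) : P.1) = 0 := by
    intro P hP
    rw [Submodule.projectionOnto_apply_eq_zero_iff]
    exact (le_sSup ⟨P.2.1, hP⟩ : P.1 ≤ sSup (s \ {N})) (Subtype.mem _)
  simp only [map_sub, LinearMap.sum_apply, map_sum, LinearMap.comp_apply, LinearEquiv.coe_coe,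
    Submodule.subtype_apply]
  rw [sub_eq_zero]
  by_cases hNF : N ∈ F
  · rw [Finset.sum_eq_single ⟨N, hNF⟩]
    · rw [hd' ⟨N, hNF⟩ x, Submodule.projectionOnto_apply_left]
    · exact fun P _ hP => hproj P fun h => hP (Subtype.ext h)
    · exact fun h => absurd (Finset.mem_univ _) h
  -- A nonzero component of g in N would make N an injective hull of S, putting N in `F`.
  · rw [Finset.sum_eq_zero fun P _ => hproj P fun h => hNF (h ▸ P.2)]
    have := injective_of_isCompl (hs.isCompl hN)
    by_contra hne
    refine hNF ⟨hN, hε.nonempty_equiv (hs.indecomposable N hN)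
      (h := Submodule.projectionOnto N _ (hs.isCompl hN) ∘ₗ g) fun h => hne ?_⟩
    exact LinearMap.congr_fun h x

theorem exists_hom_ne_zero_of_multiplicityIn_ne_zero [IsSimpleModule A S] {ε : S →ₗ[A] E}
    (hε : IsInjectiveHull ε) (h0 : multiplicityIn s E ≠ 0) : ∃ f : S →ₗ[A] M, f ≠ 0 := by
  obtain ⟨N, hN, ⟨e⟩⟩ := Set.encard_ne_zero.1 h0
  have := IsSimpleModule.nontrivial A S
  obtain ⟨x, hx⟩ := exists_ne (0 : S)
  refine ⟨N.subtype ∘ₗ e.symm.toLinearMap ∘ₗ ε, fun h => hx ?_⟩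
  have := LinearMap.congr_fun h x
  simpa [map_eq_zero_iff ε hε.injective_map] using this

end Simple

/-! ### Morphisms from a single complex in the derived category -/

section Single

open HomologicalComplex DerivedCategory

universe w' v u'

variable {C : Type u'} [Category.{v} C] [Abelian C]
  {K L : CochainComplex C ℤ} {M N : C} {i : ℤ}

/-- The morphism of complexes from `M`, placed in degree `i`, given by a morphism from `M` to the
cocycles in degree `i`. -/
def fromSingle (f : M ⟶ K.X i) (hf : f ≫ K.d i (i + 1) = 0) :
    (single C (ComplexShape.up ℤ) i).obj M ⟶ K :=
  mkHomFromSingle f (by rintro _ rfl; exact hf)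

theorem fromSingle_f (f : M ⟶ K.X i) (hf : f ≫ K.d i (i + 1) = 0) :
    (fromSingle f hf).f i = (singleObjXSelf (ComplexShape.up ℤ) i M).hom ≫ f :=
  mkHomFromSingle_f _ _

variable [HasDerivedCategory.{w'} C]

/-- The morphism in the derived category given by a morphism from `M` to the cocycles in
degree `i`. -/
def singleClass (f : M ⟶ K.X i) (hf : f ≫ K.d i (i + 1) = 0) :
    Q.obj ((single C (ComplexShape.up ℤ) i).obj M) ⟶ Q.obj K :=
  Q.map (fromSingle f hf)

theorem singleClass_add (f g : M ⟶ K.X i) (hf : f ≫ K.d i (i + 1) = 0)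
    (hg : g ≫ K.d i (i + 1) = 0) (hfg : (f + g) ≫ K.d i (i + 1) = 0) :
    singleClass (f + g) hfg = singleClass f hf + singleClass g hg := by
  rw [singleClass, singleClass, singleClass, ← Functor.map_add]
  congr 1
  apply from_single_hom_ext
  rw [add_f_apply, fromSingle_f, fromSingle_f, fromSingle_f, Preadditive.comp_add]

theorem singleClass_comp (f : M ⟶ K.X i) (hf : f ≫ K.d i (i + 1) = 0) (φ : K ⟶ L)
    (hφ : (f ≫ φ.f i) ≫ L.d i (i + 1) = 0) :
    singleClass f hf ≫ Q.map φ = singleClass (f ≫ φ.f i) hφ := by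
  rw [singleClass, singleClass, ← Functor.map_comp]
  congr 1
  apply from_single_hom_ext
  rw [comp_f, fromSingle_f, fromSingle_f, Category.assoc]

theorem map_single_comp_singleClass (g : N ⟶ M) (f : M ⟶ K.X i) (hf : f ≫ K.d i (i + 1) = 0)
    (hgf : (g ≫ f) ≫ K.d i (i + 1) = 0) :
    Q.map ((single C (ComplexShape.up ℤ) i).map g) ≫ singleClass f hf =
      singleClass (g ≫ f) hgf := by
  rw [singleClass, singleClass, ← Functor.map_comp]
  congr 1
  apply from_single_hom_ext
  rw [comp_f, fromSingle_f, fromSingle_f, single_map_f_self]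
  simp

theorem singleClass_comp_d {j : ℤ} (hj : j + 1 = i) (g : M ⟶ K.X j)
    (hg : (g ≫ K.d j i) ≫ K.d i (i + 1) = 0) : singleClass (g ≫ K.d j i) hg = 0 := by
  -- The null-homotopy is g itself, concentrated in the single bidegree (i, j).
  let H (p q : ℤ) : ((single C (ComplexShape.up ℤ) i).obj M).X p ⟶ K.X q :=
    if hp : p = i then
      if hq : q = j then
        (singleObjXIsoOfEq (ComplexShape.up ℤ) i M p hp).hom ≫ g ≫ (K.XIsoOfEq hq).inv
      else 0
    else 0
  have hH : H i j = (singleObjXSelf (ComplexShape.up ℤ) i M).hom ≫ g := by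
    simp only [H, dif_pos, XIsoOfEq_rfl, Iso.refl_inv, Category.comp_id]
    rfl
  have hf : fromSingle (g ≫ K.d j i) hg = Homotopy.nullHomotopicMap H := by
    apply from_single_hom_ext
    rw [Homotopy.nullHomotopicMap_f (show (ComplexShape.up ℤ).Rel j i from hj)
      (show (ComplexShape.up ℤ).Rel i (i + 1) from rfl), single_obj_d, Limits.zero_comp, zero_add,
      hH, fromSingle_f, Category.assoc]
  have hzero : ∀ p q, ¬ (ComplexShape.up ℤ).Rel q p → H p q = 0 := by
    intro p q hpq
    by_cases hp : p = i
    · by_cases hq : q = j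
      · exact absurd (show q + 1 = p by omega) hpq
      · simp only [H, dif_pos hp, dif_neg hq]
    · simp only [H, dif_neg hp]
  rw [singleClass, hf, Q_map_eq_of_homotopy _ (Homotopy.nullHomotopy H hzero), Functor.map_zero]

/-- Morphisms into a K-injective complex are the same in the homotopy category and in the derived
category, and homotopy classes lift to chain maps. -/
theorem Q_map_surjective_of_isKInjective [K.IsKInjective] :
    Function.Surjective (Q.map : (L ⟶ K) → (Q.obj L ⟶ Q.obj K)) := by
  intro α
  obtain ⟨β, hβ⟩ := (CochainComplex.IsKInjective.Qh_map_bijective _ K).surjective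
    ((quotientCompQhIso C).hom.app L ≫ α ≫ (quotientCompQhIso C).inv.app K)
  obtain ⟨f, rfl⟩ := (HomotopyCategory.quotient C _).map_surjective β
  refine ⟨f, ?_⟩
  have := quotientCompQhIso_hom_naturality f
  rw [hβ] at this
  simpa using this.symm

theorem homotopy_of_Q_map_eq_zero [K.IsKInjective] (f : L ⟶ K) (hf : Q.map f = 0) :
    Nonempty (Homotopy f 0) := by
  refine ⟨HomotopyCategory.homotopyOfEq _ _ ?_⟩
  refine (CochainComplex.IsKInjective.Qh_map_bijective _ K).injective ?_
  have := quotientCompQhIso_hom_naturality f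
  rw [hf, Limits.comp_zero] at this
  rw [Functor.map_zero, Functor.map_zero]
  exact (cancel_mono _).1 (this.trans Limits.zero_comp.symm)

theorem exists_singleClass_eq [K.IsKInjective]
    (α : Q.obj ((single C (ComplexShape.up ℤ) i).obj M) ⟶ Q.obj K) :
    ∃ (f : M ⟶ K.X i) (hf : f ≫ K.d i (i + 1) = 0), singleClass f hf = α := by
  obtain ⟨φ, rfl⟩ := Q_map_surjective_of_isKInjective α
  refine ⟨(singleObjXSelf (ComplexShape.up ℤ) i M).inv ≫ φ.f i, ?_, ?_⟩
  · rw [Category.assoc, φ.comm, single_obj_d, Limits.zero_comp, Limits.comp_zero]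
  · rw [singleClass]
    congr 1
    apply from_single_hom_ext
    rw [fromSingle_f, Iso.hom_inv_id_assoc]

theorem exists_comp_d_eq_of_singleClass_eq_zero [K.IsKInjective] {j : ℤ} (hj : j + 1 = i)
    {f : M ⟶ K.X i} {hf : f ≫ K.d i (i + 1) = 0} (h : singleClass f hf = 0) :
    ∃ g : M ⟶ K.X j, f = g ≫ K.d j i := by
  obtain ⟨H⟩ := homotopy_of_Q_map_eq_zero _ h
  have := H.comm i
  rw [dNext_eq H.hom (show (ComplexShape.up ℤ).Rel i (i + 1) from rfl), single_obj_d,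
    Limits.zero_comp, zero_add, zero_f, add_zero,
    prevD_eq H.hom (show (ComplexShape.up ℤ).Rel j i from hj), fromSingle_f] at this
  refine ⟨(singleObjXSelf (ComplexShape.up ℤ) i M).inv ≫ H.hom i j, ?_⟩
  rw [Category.assoc, ← this, Iso.inv_hom_id_assoc]

/-! ### Modules of morphisms in the derived category -/

variable {D : Type*} [Category D] [Preadditive D] {Λ : Type*} [Ring Λ] {X : D}

/-- The group `Hom(Y, X)`, viewed as a module over a ring `Λ` that acts on `X`. -/
def HomModule (_ρ : Λ →+* End X) (Y : D) := Y ⟶ X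

instance (ρ : Λ →+* End X) (Y : D) : AddCommGroup (HomModule ρ Y) :=
  inferInstanceAs (AddCommGroup (Y ⟶ X))

/-- The action is determined by ρ, which is why ρ is part of the type `HomModule`. -/
instance (ρ : Λ →+* End X) (Y : D) : Module Λ (HomModule ρ Y) :=
  Module.compHom (Y ⟶ X) ρ

/-- Precomposition, as a linear map. -/
def HomModule.precomp (ρ : Λ →+* End X) {Y Z : D} (g : Y ⟶ Z) :
    HomModule ρ Z →ₗ[Λ] HomModule ρ Y where
  toFun α := g ≫ (show Z ⟶ X from α)
  map_add' _ _ := Preadditive.comp_add _ _ _ _ _ _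
  map_smul' _ _ := (Category.assoc _ _ _).symm

theorem HomModule.isNoetherian_of_iso (ρ : Λ →+* End X) {Y Z : D} (e : Y ≅ Z)
    [IsNoetherian Λ (HomModule ρ Y)] : IsNoetherian Λ (HomModule ρ Z) := by
  refine isNoetherian_of_injective (HomModule.precomp ρ e.hom) fun α β h => ?_
  exact (cancel_epi e.hom).1 h

end Single

/-! ### Long exact sequences of morphism modules -/

section Noetherian

open HomologicalComplex DerivedCategory Pretriangulated

universe w' v u'

variable {C : Type u'} [Category.{v} C] [Abelian C] [HasDerivedCategory.{w'} C]
  {Λ : Type*} [Ring Λ] {X : DerivedCategory C} (ρ : Λ →+* End X)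

/-- Placing an object in degree `i` and shifting by `1` places it in degree `i - 1`. -/
def singleShift (M : C) {i j : ℤ} (hj : j + 1 = i) :
    (Q.obj ((single C (ComplexShape.up ℤ) i).obj M))⟦(1 : ℤ)⟧ ≅
      Q.obj ((single C (ComplexShape.up ℤ) j).obj M) :=
  ((DerivedCategory.singleFunctors C).shiftIso 1 j i (by omega)).app M

/-- This is the exact piece Ext^(i-1)(S.X₁, X) → Ext^i(S.X₃, X) → Ext^i(S.X₂, X) of the long exact
sequence: a module in degree i represents Ext^i, and shifting by 1 lowers the degree. -/
theorem isNoetherian_homModule_of_shortExact {S : ShortComplex C} (hS : S.ShortExact) {i j : ℤ}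
    (hj : j + 1 = i)
    [IsNoetherian Λ (HomModule ρ (Q.obj ((single C (ComplexShape.up ℤ) j).obj S.X₁)))]
    [IsNoetherian Λ (HomModule ρ (Q.obj ((single C (ComplexShape.up ℤ) i).obj S.X₂)))] :
    IsNoetherian Λ (HomModule ρ (Q.obj ((single C (ComplexShape.up ℤ) i).obj S.X₃))) := by
  let T := triangleOfSES (hS.map_of_exact (single C (ComplexShape.up ℤ) i))
  have hT : T ∈ distTriang (DerivedCategory C) := triangleOfSES_distinguished _
  have : IsNoetherian Λ (HomModule ρ (T.obj₁⟦(1 : ℤ)⟧)) :=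
    HomModule.isNoetherian_of_iso ρ (singleShift S.X₁ hj).symm
  have : IsNoetherian Λ (HomModule ρ T.obj₂) := ‹_›
  refine isNoetherian_of_range_eq_ker (HomModule.precomp ρ T.mor₃) (HomModule.precomp ρ T.mor₂) ?_
  ext α
  constructor
  · rintro ⟨(β : T.obj₁⟦(1 : ℤ)⟧ ⟶ X), rfl⟩
    exact (comp_distTriang_mor_zero₂₃_assoc T hT β).trans Limits.zero_comp
  · intro hα
    obtain ⟨β, hβ⟩ := Triangle.yoneda_exact₃ T hT α hα
    exact ⟨β, hβ.symm⟩

end Noetherian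

/-! ### Finiteness of the modules `Hom(M, X[i])` for finitely generated `M` -/

section Finite

open HomologicalComplex DerivedCategory

universe w'

variable {A : Type u} [Ring A] [HasDerivedCategory.{w'} (ModuleCat.{u} A)]
  {Λ : Type*} [Ring Λ] {X : DerivedCategory (ModuleCat.{u} A)} (ρ : Λ →+* End X)

/-- Additivity makes restriction to the n coordinate copies of A injective on morphisms out of Aⁿ.
-/
theorem isNoetherian_homModule_pi (i : ℤ) (n : ℕ)
    [IsNoetherian Λ
      (HomModule ρ (Q.obj ((single _ (ComplexShape.up ℤ) i).obj (ModuleCat.of A A))))] :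
    IsNoetherian Λ
      (HomModule ρ (Q.obj ((single _ (ComplexShape.up ℤ) i).obj (ModuleCat.of A (Fin n → A))))) := by
  let F : ModuleCat.{u} A ⥤ DerivedCategory (ModuleCat.{u} A) :=
    single _ (ComplexShape.up ℤ) i ⋙ Q
  let ι : Fin n → (ModuleCat.of A A ⟶ ModuleCat.of A (Fin n → A)) := fun j =>
    ModuleCat.ofHom (LinearMap.single A (fun _ => A) j)
  let π : Fin n → (ModuleCat.of A (Fin n → A) ⟶ ModuleCat.of A A) := fun j =>
    ModuleCat.ofHom (LinearMap.proj j)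
  have hid : ∑ j, π j ≫ ι j = 𝟙 _ := by
    ext x : 2
    rw [ModuleCat.hom_sum]
    ext k
    simp [π, ι, Pi.single_apply]
  have hF : ∑ j, F.map (π j) ≫ F.map (ι j) = 𝟙 _ := by
    rw [← F.map_id, ← hid, F.map_sum]
    simp only [F.map_comp]
  have : IsNoetherian Λ (HomModule ρ (F.obj (ModuleCat.of A A))) := ‹_›
  refine isNoetherian_of_injective (LinearMap.pi fun j => HomModule.precomp ρ (F.map (ι j)))
    fun (α : F.obj _ ⟶ X) (β : F.obj _ ⟶ X) h => ?_
  have h' : ∀ j, F.map (ι j) ≫ α = F.map (ι j) ≫ β := fun j => congrFun h j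
  calc α = (∑ j, F.map (π j) ≫ F.map (ι j)) ≫ α := by rw [hF, Category.id_comp]
    _ = (∑ j, F.map (π j) ≫ F.map (ι j)) ≫ β := by
      simp only [Preadditive.sum_comp, Category.assoc, h']
    _ = β := by rw [hF, Category.id_comp]

/-- If `Hom(A, X[i])` is a noetherian `Λ`-module for all `i`, and zero for `i ≪ 0`, then
`Hom(M, X[i])` is a noetherian `Λ`-module for all finitely generated `M`. -/
theorem isNoetherian_homModule_of_finite [IsNoetherianRing A]
    (hA : ∀ i : ℤ, IsNoetherian Λ
      (HomModule ρ (Q.obj ((single _ (ComplexShape.up ℤ) i).obj (ModuleCat.of A A)))))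
    (i₀ : ℤ) (hX : ∀ i < i₀, ∀ M : ModuleCat.{u} A,
      Subsingleton (HomModule ρ (Q.obj ((single _ (ComplexShape.up ℤ) i).obj M))))
    (i : ℤ) (M : Type u) [AddCommGroup M] [Module A M] [Module.Finite A M] :
    IsNoetherian Λ
      (HomModule ρ (Q.obj ((single _ (ComplexShape.up ℤ) i).obj (ModuleCat.of A M)))) := by
  -- Dimension shifting by induction on the distance from the vanishing range i < i₀: M is replaced
  -- by the kernel of A^m → M, finitely generated as A is noetherian, one degree lower.
  suffices h : ∀ (n : ℕ) (i : ℤ), i < i₀ + n → ∀ (M : Type u) [AddCommGroup M] [Module A M]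
      [Module.Finite A M], IsNoetherian Λ
        (HomModule ρ (Q.obj ((single _ (ComplexShape.up ℤ) i).obj (ModuleCat.of A M)))) from
    h (i - i₀ + 1).toNat i (by omega) M
  intro n
  induction n with
  | zero =>
    intro i hi M _ _ _
    have := hX i (by simpa using hi) (ModuleCat.of A M)
    infer_instance
  | succ n ih =>
    intro i hi M _ _ _
    obtain ⟨m, f, hf⟩ := Module.Finite.exists_fin' A M
    have := hA i
    have h₁ := ih (i - 1) (by push_cast at hi; omega) (LinearMap.ker f)
    have h₂ := isNoetherian_homModule_pi ρ i m
    have hS := LinearMap.shortExact_shortComplexKer hf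
    exact @isNoetherian_homModule_of_shortExact _ _ _ _ _ _ _ ρ _ hS i (i - 1) (by omega) h₁ h₂

end Finite

/-! ### Cocycles as morphisms from the free module -/

section Cocycles

open HomologicalComplex DerivedCategory

universe w'

variable {A : Type u} [Ring A] {K I : CochainComplex (ModuleCat.{u} A) ℤ} {i : ℤ}

/-- The map from the free module of rank one with a given value at `1`. -/
def ofElement {M : ModuleCat.{u} A} (x : M) : ModuleCat.of A A ⟶ M :=
  ModuleCat.ofHom (LinearMap.toSpanSingleton A M x)

theorem ofElement_comp {M N : ModuleCat.{u} A} (x : M) (g : M ⟶ N) :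
    ofElement x ≫ g = ofElement (g.hom x) := by
  ext
  simp [ofElement]

theorem ofElement_apply_one {M : ModuleCat.{u} A} (f : ModuleCat.of A A ⟶ M) :
    ofElement (f.hom (1 : A)) = f := by
  ext
  simp [ofElement]

theorem ofElement_zero {M : ModuleCat.{u} A} : ofElement (0 : M) = 0 := by
  ext
  simp [ofElement]

theorem ofElement_comp_eq_zero {x : K.X i} (hx : (K.d i (i + 1)).hom x = 0) :
    ofElement x ≫ K.d i (i + 1) = 0 := by
  rw [ofElement_comp, hx, ofElement_zero]

theorem exists_iCycles_eq {x : K.X i} (hx : (K.d i (i + 1)).hom x = 0) :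
    ∃ c : K.cycles i, (K.iCycles i).hom c = x := by
  let l := K.liftCycles (ofElement x) (i + 1) (by simp) (ofElement_comp_eq_zero hx)
  have hl : l ≫ K.iCycles i = ofElement x := K.liftCycles_i _ _ _ _
  refine ⟨l.hom (1 : A), ?_⟩
  have := congrArg (fun f => f.hom (1 : A)) hl
  simpa [ofElement] using this

theorem d_iCycles (c : K.cycles i) : (K.d i (i + 1)).hom ((K.iCycles i).hom c) = 0 :=
  LinearMap.congr_fun (congrArg ModuleCat.Hom.hom (K.iCycles_d i (i + 1))) c

theorem homologyπ_surjective : Function.Surjective (K.homologyπ i).hom :=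
  (ModuleCat.epi_iff_surjective _).1 inferInstance

theorem exists_d_eq_of_homologyπ_eq_zero {j : ℤ} (hj : j + 1 = i) {c : K.cycles i}
    (hc : (K.homologyπ i).hom c = 0) : ∃ w : K.X j, (K.d j i).hom w = (K.iCycles i).hom c := by
  have hex := ShortComplex.exact_of_g_is_cokernel
    (ShortComplex.mk _ _ (K.toCycles_comp_homologyπ j i))
    (K.homologyIsCokernel j i (by simp; omega))
  obtain ⟨w, hw⟩ := (ShortComplex.moduleCat_exact_iff _).1 hex c hc
  refine ⟨w, ?_⟩
  have := congrArg (fun f => f.hom w) (K.toCycles_i j i)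
  rw [← this]
  exact congrArg _ hw

/-- A quasi-isomorphism hits every cocycle, up to a coboundary. -/
theorem exists_cocycle_of_quasiIso (φ : K ⟶ I) [QuasiIso φ] {j : ℤ} (hj : j + 1 = i) {z : I.X i}
    (hz : (I.d i (i + 1)).hom z = 0) :
    ∃ (x : K.X i) (w : I.X j), (K.d i (i + 1)).hom x = 0 ∧
      (φ.f i).hom x = z + (I.d j i).hom w := by
  obtain ⟨c, rfl⟩ := exists_iCycles_eq hz
  have hsurj : Function.Surjective (homologyMap φ i).hom :=
    (ModuleCat.epi_iff_surjective _).1 inferInstance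
  obtain ⟨y, hy⟩ := hsurj ((I.homologyπ i).hom c)
  obtain ⟨c', rfl⟩ := homologyπ_surjective y
  have h1 := congrArg (fun f => f.hom c') (homologyπ_naturality φ i)
  simp only [ModuleCat.hom_comp, LinearMap.comp_apply] at h1
  rw [hy] at h1
  obtain ⟨w, hw⟩ := exists_d_eq_of_homologyπ_eq_zero (K := I) hj
    (c := (cyclesMap φ i).hom c' - c) (by rw [map_sub, ← h1, sub_self])
  refine ⟨(K.iCycles i).hom c', w, d_iCycles c', ?_⟩
  have h2 := congrArg (fun f => f.hom c') (cyclesMap_i φ i)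
  simp only [ModuleCat.hom_comp, LinearMap.comp_apply] at h2
  rw [hw, map_sub, h2]
  abel

variable [HasDerivedCategory.{w'} (ModuleCat.{u} A)]

/-- The morphism from the free module of rank one given by a cocycle. -/
def elementClass (x : K.X i) (hx : (K.d i (i + 1)).hom x = 0) :
    Q.obj ((single _ (ComplexShape.up ℤ) i).obj (ModuleCat.of A A)) ⟶ Q.obj K :=
  singleClass (ofElement x) (ofElement_comp_eq_zero hx)

theorem elementClass_add {x y : K.X i} (hx : (K.d i (i + 1)).hom x = 0)
    (hy : (K.d i (i + 1)).hom y = 0) (hxy : (K.d i (i + 1)).hom (x + y) = 0) :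
    elementClass (x + y) hxy = elementClass x hx + elementClass y hy := by
  have : ofElement (x + y) = ofElement x + ofElement y := by
    ext
    simp [ofElement]
  rw [elementClass, elementClass, elementClass, ← singleClass_add _ _ _ _ (by
    rw [← this]; exact ofElement_comp_eq_zero hxy)]
  simp only [this]

theorem elementClass_comp {x : K.X i} (hx : (K.d i (i + 1)).hom x = 0) (φ : K ⟶ I)
    (hφ : (I.d i (i + 1)).hom ((φ.f i).hom x) = 0) :
    elementClass x hx ≫ Q.map φ = elementClass ((φ.f i).hom x) hφ := by
  rw [elementClass, elementClass, singleClass_comp _ _ _ (by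
    rw [ofElement_comp]; exact ofElement_comp_eq_zero hφ)]
  simp only [ofElement_comp]

theorem elementClass_d {j : ℤ} (hj : j + 1 = i) (w : K.X j)
    (hw : (K.d i (i + 1)).hom ((K.d j i).hom w) = 0) :
    elementClass ((K.d j i).hom w) hw = 0 := by
  rw [elementClass]
  simp only [← ofElement_comp]
  exact singleClass_comp_d hj _ _

/-- The K-injective I supplies a representing cocycle, which the quasi-isomorphism lifts to K up to
a coboundary. Having it in K itself matters: the second ring acts on R, not on I. -/
theorem exists_elementClass_eq [I.IsKInjective] (φ : K ⟶ I) [QuasiIso φ]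
    (α : Q.obj ((single _ (ComplexShape.up ℤ) i).obj (ModuleCat.of A A)) ⟶ Q.obj K) :
    ∃ (x : K.X i) (hx : (K.d i (i + 1)).hom x = 0), elementClass x hx = α := by
  obtain ⟨f, hf, hfα⟩ := exists_singleClass_eq (α ≫ Q.map φ)
  have hz : (I.d i (i + 1)).hom (f.hom (1 : A)) = 0 := by
    have := congrArg (fun g => g.hom (1 : A)) hf
    simpa using this
  obtain ⟨x, w, hx, hxw⟩ := exists_cocycle_of_quasiIso φ (sub_add_cancel i 1) hz
  have hdw : (I.d i (i + 1)).hom ((I.d (i - 1) i).hom w) = 0 :=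
    LinearMap.congr_fun (congrArg ModuleCat.Hom.hom (I.d_comp_d (i - 1) i (i + 1))) w
  refine ⟨x, hx, ?_⟩
  have hφx : (I.d i (i + 1)).hom ((φ.f i).hom x) = 0 := by rw [hxw, map_add, hz, hdw, add_zero]
  rw [← cancel_mono (Q.map φ), elementClass_comp hx φ hφx, ← hfα]
  simp only [hxw]
  rw [elementClass_add hz hdw, elementClass_d (sub_add_cancel i 1), add_zero, elementClass]
  congr 1
  exact ofElement_apply_one f

end Cocycles

/-! ### The second ring action and the cohomology of R -/

section Homothety

open HomologicalComplex DerivedCategory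

universe w'

variable {C D T : Type u} [Ring C] [Ring D] [Ring T] (f : C →+* T) (g : D →+* T)
  (h : ∀ c d, Commute (f c) (g d)) (R : CochainComplex (ModuleCat.{u} T) ℤ)
  [HasDerivedCategory.{w'} (ModuleCat.{u} C)]

/-- The action of `D` on the object `R` of the derived category of `C`-modules. -/
def homothety : D →+* End (Q.obj (restrict f R)) where
  toFun d := Q.map (smulEnd f (g d) (fun c => h c d) R)
  map_one' := by
    refine Eq.trans ?_ (Q.map_id _)
    congr 1
    ext i x
    change g 1 • (show R.X i from x) = x
    rw [map_one, one_smul]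
  map_mul' d e := by
    change _ = Q.map _ ≫ Q.map _
    rw [← Q.map_comp]
    congr 1
    ext i x
    change g (d * e) • (show R.X i from x) = g d • g e • (show R.X i from x)
    rw [map_mul, mul_smul]
  map_zero' := by
    rw [← Q.map_zero]
    congr 1
    ext i x
    change g 0 • (show R.X i from x) = 0
    rw [map_zero, zero_smul]
  map_add' d e := by
    rw [← Q.map_add]
    congr 1
    ext i x
    change g (d + e) • (show R.X i from x) = g d • (show R.X i from x) + g e • (show R.X i from x)
    rw [map_add, add_smul]

variable {R} {I : CochainComplex (ModuleCat.{u} C) ℤ}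

/-- `Hom(C, R[i])` is a quotient of the cohomology of `R`, as `D`-modules. -/
theorem isNoetherian_homModule_free [I.IsKInjective] (φ : restrict f R ⟶ I) [QuasiIso φ] (i : ℤ)
    [IsNoetherian D ((restrict g R).homology i)] :
    IsNoetherian D (HomModule (homothety f g h R)
      (Q.obj ((single _ (ComplexShape.up ℤ) i).obj (ModuleCat.of C C)))) := by
  let Kc := restrict f R
  let Kd := restrict g R
  -- The restrictions of R to C and to D share elements and differentials, so a cocycle of one is a
  -- cocycle of the other. This lets D-linear cohomology control morphisms of C-modules.
  let ψ : Kd.cycles i →ₗ[D] HomModule (homothety f g h R)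
      (Q.obj ((single _ (ComplexShape.up ℤ) i).obj (ModuleCat.of C C))) :=
    { toFun := fun c => elementClass (K := Kc) ((Kd.iCycles i).hom c) (d_iCycles (K := Kd) c)
      map_add' := fun c c' => by
        simp only [map_add]
        exact elementClass_add (K := Kc) _ _ _
      map_smul' := fun d c => by
        simp only [map_smul]
        exact (elementClass_comp (K := Kc) (d_iCycles (K := Kd) c)
          (smulEnd f (g d) (fun c => h c d) R) _).symm }
  have hψ : Function.Surjective ψ := by
    intro α
    obtain ⟨x, hx, hxα⟩ := exists_elementClass_eq φ α
    obtain ⟨c, rfl⟩ := exists_iCycles_eq (K := Kd) hx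
    exact ⟨c, hxα⟩
  have hker : LinearMap.ker (Kd.homologyπ i).hom ≤ LinearMap.ker ψ := by
    intro c hc
    obtain ⟨w, hw⟩ := exists_d_eq_of_homologyπ_eq_zero (K := Kd) (sub_add_cancel i 1) hc
    change elementClass (K := Kc) ((Kd.iCycles i).hom c) (d_iCycles (K := Kd) c) = 0
    simp only [← hw]
    exact elementClass_d (K := Kc) (sub_add_cancel i 1) w _
  have e := (Kd.homologyπ i).hom.quotKerEquivOfSurjective homologyπ_surjective
  have : IsNoetherian D (Kd.cycles i ⧸ LinearMap.ker (Kd.homologyπ i).hom) :=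
    isNoetherian_of_linearEquiv e.symm
  refine isNoetherian_of_surjective ((LinearMap.ker (Kd.homologyπ i).hom).liftQ ψ hker) ?_
  rw [Submodule.range_liftQ, LinearMap.range_eq_top.2 hψ]

end Homothety

/-! ### Morphisms from a simple module to a minimal injective complex -/

section Minimal

open HomologicalComplex DerivedCategory

universe w'

variable {A : Type u} [Ring A] {I : CochainComplex (ModuleCat.{u} A) ℤ}

theorem IsMinimalInjectiveComplex.isKInjective (hI : IsMinimalInjectiveComplex I) :
    I.IsKInjective := by
  obtain ⟨n, hn⟩ := hI.boundedBelow
  have := hI.injective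
  have : I.IsStrictlyGE n := (CochainComplex.isStrictlyGE_iff _ _).2 hn
  exact CochainComplex.isKInjective_of_injective I n

/-- This is where minimality enters: an essential submodule contains every simple image. -/
theorem IsMinimalInjectiveComplex.comp_d {S : Type u} [AddCommGroup S] [Module A S]
    [IsSimpleModule A S] (hI : IsMinimalInjectiveComplex I) {i : ℤ}
    (f : ModuleCat.of A S ⟶ I.X i) : f ≫ I.d i (i + 1) = 0 := by
  ext x
  exact (hI.essential i).apply_mem f.hom x

variable [HasDerivedCategory.{w'} (ModuleCat.{u} A)] {K : CochainComplex (ModuleCat.{u} A) ℤ}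

/-- I is K-injective and vanishes in low degrees; this starts the dimension-shifting induction. -/
theorem exists_subsingleton_homModule {Λ : Type*} [Ring Λ] (φ : K ⟶ I)
    (hφ : IsMinimalInjectiveResolution φ) (ρ : Λ →+* End (Q.obj K)) :
    ∃ i₀ : ℤ, ∀ i < i₀, ∀ M : ModuleCat.{u} A,
      Subsingleton (HomModule ρ (Q.obj ((single _ (ComplexShape.up ℤ) i).obj M))) := by
  obtain ⟨n, hn⟩ := hφ.minimal.boundedBelow
  have := hφ.minimal.isKInjective
  have := hφ.quasiIso
  refine ⟨n, fun i hi M => subsingleton_of_forall_eq 0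
    fun (α : Q.obj ((single _ (ComplexShape.up ℤ) i).obj M) ⟶ Q.obj K) => ?_⟩
  obtain ⟨β, hβ⟩ := Q_map_surjective_of_isKInjective (α ≫ Q.map φ)
  have hβ0 : β = 0 := from_single_hom_ext ((hn i hi).eq_of_tgt _ _)
  have : α ≫ Q.map φ = 0 := by rw [← hβ, hβ0, Functor.map_zero]
  exact (cancel_mono (Q.map φ)).1 (this.trans Limits.zero_comp.symm)

variable (S : Type u) [AddCommGroup S] [Module A S]

/-- Endomorphisms of a module act on the corresponding single complex. -/
def singleEnd (i : ℤ) : Module.End A S →+*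
    End (Q.obj ((single (ModuleCat.{u} A) (ComplexShape.up ℤ) i).obj (ModuleCat.of A S))) where
  toFun d := Q.map ((single _ _ i).map (ModuleCat.ofHom d))
  map_one' := ((single _ (ComplexShape.up ℤ) i ⋙ Q).map_id (ModuleCat.of A S))
  map_mul' d e := ((single _ (ComplexShape.up ℤ) i ⋙ Q).map_comp
    (ModuleCat.ofHom (X := S) (Y := S) e) (ModuleCat.ofHom d))
  map_zero' := ((single _ (ComplexShape.up ℤ) i ⋙ Q).map_zero (ModuleCat.of A S) (ModuleCat.of A S))
  map_add' d e := ((single _ (ComplexShape.up ℤ) i ⋙ Q).map_add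
    (f := ModuleCat.ofHom d) (g := ModuleCat.ofHom e))

instance {Λ : Type*} [Ring Λ] {X : DerivedCategory (ModuleCat.{u} A)} (ρ : Λ →+* End X) (i : ℤ) :
    Module (Module.End A S)ᵐᵒᵖ (HomModule ρ
      (Q.obj ((single (ModuleCat.{u} A) (ComplexShape.up ℤ) i).obj (ModuleCat.of A S)))) :=
  Module.compHom (Q.obj ((single (ModuleCat.{u} A) (ComplexShape.up ℤ) i).obj
    (ModuleCat.of A S)) ⟶ X) (RingHom.op (singleEnd S i))

/-- Postcomposition and precomposition commute; this is the bimodule structure on Ext^i(S, R). -/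
instance {Λ : Type*} [Ring Λ] {X : DerivedCategory (ModuleCat.{u} A)} (ρ : Λ →+* End X) (i : ℤ) :
    SMulCommClass Λ (Module.End A S)ᵐᵒᵖ (HomModule ρ
      (Q.obj ((single (ModuleCat.{u} A) (ComplexShape.up ℤ) i).obj (ModuleCat.of A S)))) where
  smul_comm _ _ _ := Category.assoc _ _ _

variable {S} [IsSimpleModule A S] {Λ : Type*} [Ring Λ] {φ : K ⟶ I}

/-- For a simple module `S`, the differentials of `Hom(S, I)` vanish, so that `Hom(S, Iⁱ)` is
`Hom(S, K[i])` in the derived category. -/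
def homSimple (hφ : IsMinimalInjectiveResolution φ) (ρ : Λ →+* End (Q.obj K)) (i : ℤ) :
    (S →ₗ[A] I.X i) →+
      HomModule ρ (Q.obj ((single _ (ComplexShape.up ℤ) i).obj (ModuleCat.of A S))) :=
  have := hφ.quasiIso
  { toFun := fun f =>
      singleClass (ModuleCat.ofHom f) (hφ.minimal.comp_d _) ≫ inv (Q.map φ)
    map_zero' := by
      have h0 : singleClass (ModuleCat.ofHom (0 : S →ₗ[A] I.X i)) (hφ.minimal.comp_d _) = 0 := by
        have := singleClass_comp_d (K := I) (sub_add_cancel i 1)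
          (0 : ModuleCat.of A S ⟶ I.X (i - 1)) (hφ.minimal.comp_d _)
        simp only [Limits.zero_comp] at this
        exact this
      exact (congrArg (· ≫ inv (Q.map φ)) h0).trans Limits.zero_comp
    map_add' := fun f g => by
      have h0 := singleClass_add (ModuleCat.ofHom f) (ModuleCat.ofHom g)
        (hφ.minimal.comp_d _) (hφ.minimal.comp_d _) (hφ.minimal.comp_d _)
      exact (congrArg (· ≫ inv (Q.map φ)) h0).trans (Preadditive.add_comp _ _ _ _ _ _) }

theorem homSimple_comp (hφ : IsMinimalInjectiveResolution φ) (ρ : Λ →+* End (Q.obj K)) (i : ℤ)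
    (f : S →ₗ[A] I.X i) (d : Module.End A S) :
    homSimple hφ ρ i (f ∘ₗ d) = MulOpposite.op d • homSimple hφ ρ i f := by
  have := hφ.quasiIso
  have h := map_single_comp_singleClass (ModuleCat.ofHom (X := S) (Y := S) d) (ModuleCat.ofHom f)
    (hφ.minimal.comp_d _) (hφ.minimal.comp_d _)
  exact (congrArg (· ≫ inv (Q.map φ)) h.symm).trans (Category.assoc _ _ _)

theorem homSimple_surjective (hφ : IsMinimalInjectiveResolution φ)
    (ρ : Λ →+* End (Q.obj K)) (i : ℤ) :
    Function.Surjective (homSimple (S := S) hφ ρ i) := by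
  intro (α : Q.obj ((single _ (ComplexShape.up ℤ) i).obj (ModuleCat.of A S)) ⟶ Q.obj K)
  have := hφ.minimal.isKInjective
  have := hφ.quasiIso
  obtain ⟨f, hf, hfα⟩ := exists_singleClass_eq (α ≫ Q.map φ)
  refine ⟨f.hom, ?_⟩
  change singleClass f hf ≫ inv (Q.map φ) = α
  rw [hfα, Category.assoc, IsIso.hom_inv_id, Category.comp_id]

theorem homSimple_injective (hφ : IsMinimalInjectiveResolution φ)
    (ρ : Λ →+* End (Q.obj K)) (i : ℤ) :
    Function.Injective (homSimple (S := S) hφ ρ i) := by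
  have := hφ.minimal.isKInjective
  have := hφ.quasiIso
  refine (injective_iff_map_eq_zero _).2 fun f hf => ?_
  have h0 : singleClass (ModuleCat.ofHom f) (hφ.minimal.comp_d _) = 0 :=
    (cancel_mono (inv (Q.map φ))).1 (Eq.trans hf Limits.zero_comp.symm)
  obtain ⟨j, rfl⟩ : ∃ j, i = j + 1 := ⟨i - 1, by ring⟩
  -- A trivial class is a coboundary g ≫ d with g a map from S, and such composites vanish by
  -- minimality.
  obtain ⟨g, hg⟩ := exists_comp_d_eq_of_singleClass_eq_zero rfl h0
  rw [hφ.minimal.comp_d] at hg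
  exact congrArg ModuleCat.Hom.hom hg

/-- If the injective hull of `S` has finite multiplicity in a decomposition of `Iⁱ`, then
`Hom(S, K[i])` is finite-dimensional over `End(S)ᵒᵖ`. -/
theorem finite_homModule_of_multiplicityIn_ne_top
    (hφ : IsMinimalInjectiveResolution φ) (ρ : Λ →+* End (Q.obj K)) (i : ℤ)
    {E : Type u} [AddCommGroup E] [Module A E] {ε : S →ₗ[A] E} (hε : IsInjectiveHull ε)
    {s : Set (Submodule A (I.X i))}
    (hs : IsIndecomposableDecomposition s) (hfin : multiplicityIn s E ≠ ⊤) :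
    Module.Finite (Module.End A S)ᵐᵒᵖ
      (HomModule ρ (Q.obj ((single _ (ComplexShape.up ℤ) i).obj (ModuleCat.of A S)))) := by
  have := hφ.minimal.injective i
  have : Module.Injective A (I.X i) := Module.injective_module_of_injective_object A (I.X i)
  obtain ⟨ι, _, f, hf⟩ := hs.exists_span_hom hε hfin
  refine Module.Finite.of_surjective
    (Fintype.linearCombination (Module.End A S)ᵐᵒᵖ fun j => homSimple hφ ρ i (f j)) fun α => ?_
  obtain ⟨g, rfl⟩ := homSimple_surjective hφ ρ i α
  obtain ⟨d, rfl⟩ := hf g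
  refine ⟨fun j => MulOpposite.op (d j), ?_⟩
  rw [Fintype.linearCombination_apply, map_sum]
  simp only [homSimple_comp]

theorem nontrivial_homModule_of_multiplicityIn_ne_zero
    (hφ : IsMinimalInjectiveResolution φ) (ρ : Λ →+* End (Q.obj K)) (i : ℤ)
    {E : Type u} [AddCommGroup E] [Module A E] {ε : S →ₗ[A] E} (hε : IsInjectiveHull ε)
    {s : Set (Submodule A (I.X i))}
    (h0 : multiplicityIn s E ≠ 0) :
    Nontrivial
      (HomModule ρ (Q.obj ((single _ (ComplexShape.up ℤ) i).obj (ModuleCat.of A S)))) := by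
  obtain ⟨f, hf⟩ := exists_hom_ne_zero_of_multiplicityIn_ne_zero hε h0
  have : Nontrivial (S →ₗ[A] I.X i) := ⟨f, 0, hf⟩
  exact (homSimple_injective hφ ρ i).nontrivial

end Minimal

end

end NCDualizing

theorem proposition5p5 {k : Type w} {A B : Type u} [Field k] [Ring A] [Algebra k A] [Ring B]
    [Algebra k B] (R : CochainComplex (ModuleCat.{u} (NCDualizing.BimodRing k A B)) ℤ)
    (hR : NCDualizing.IsDualizingComplex k A B R)
    -- no quotient of `B` by a proper two-sided ideal is right artinian
    (hB : ∀ b : TwoSidedIdeal B, b ≠ ⊤ → ¬ IsArtinianRing (b.ringCon.Quotient)ᵐᵒᵖ)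
    -- a minimal injective resolution of `R` as a complex of `A`-modules
    (I : CochainComplex (ModuleCat.{u} A) ℤ)
    (φ : NCDualizing.restrict (NCDualizing.inlHom k A B) R ⟶ I)
    (hφ : NCDualizing.IsMinimalInjectiveResolution φ)
    -- a simple `A`-module and its injective hull
    (S E : Type u) [AddCommGroup S] [Module A S] [IsSimpleModule A S]
    [AddCommGroup E] [Module A E] (ε : S →ₗ[A] E) (hε : NCDualizing.IsInjectiveHull ε)
    (i : ℤ) :
    (∃ s : Set (Submodule A (I.X i)), NCDualizing.IsIndecomposableDecomposition s) ∧
    ∀ s : Set (Submodule A (I.X i)), NCDualizing.IsIndecomposableDecomposition s →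
      NCDualizing.multiplicityIn s E = 0 ∨ NCDualizing.multiplicityIn s E = ⊤ := by
  classical
  have := hR.noetherian_left
  have := hR.noetherian_right
  have := hφ.minimal.injective i
  have := hφ.minimal.isKInjective
  have := hφ.quasiIso
  have : Module.Injective A (I.X i) := Module.injective_module_of_injective_object A (I.X i)
  refine ⟨NCDualizing.exists_isIndecomposableDecomposition, fun s hs => ?_⟩
  by_contra! hne
  let := HasDerivedCategory.standard (ModuleCat.{u} A)
  let ρ := NCDualizing.homothety (NCDualizing.inlHom k A B) (NCDualizing.inrHom k A B)
    (NCDualizing.commute_inl_inr k A B) R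
  obtain ⟨i₀, hi₀⟩ := NCDualizing.exists_subsingleton_homModule φ hφ ρ
  have := NCDualizing.isNoetherian_homModule_of_finite ρ (fun j => by
    have := hR.finite_right j
    exact NCDualizing.isNoetherian_homModule_free _ _ _ φ j) i₀ hi₀ i S
  have := NCDualizing.finite_homModule_of_multiplicityIn_ne_top hφ ρ i hε hs hne.2
  have := NCDualizing.nontrivial_homModule_of_multiplicityIn_ne_zero hφ ρ i hε hne.1
  -- By Schur's lemma End(S)ᵒᵖ is a division ring, so Ext^i(S, R) meets the requirements for a right
  -- artinian quotient of B.
  obtain ⟨b, hb, hb'⟩ := NCDualizing.exists_twoSidedIdeal_isArtinianRing B (Module.End A S)ᵐᵒᵖ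
    (NCDualizing.HomModule ρ (DerivedCategory.Q.obj
      ((HomologicalComplex.single _ (ComplexShape.up ℤ) i).obj (ModuleCat.of A S))))
  exact hB b hb hb'
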